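/- **Online matching with additive budgets.** There is a finite set $L$ of offline vertices, each with a budget $W_i>0$. Online vertices $j=1,\dots,n$ arrive one by one, in an order fixed in advance; when $j$ arrives, its weights $w_{ij}\ge 0$ ($i\in L$) are revealed (a missing edge has weight $0$), and $j$ must be assigned irrevocably to at most one $i\in L$. If $M_i$ is the set of online vertices assigned to $i$ in the assignment $M$, the reward of $M$ is $c(M)=\sum_{i\in L}\min\{W_i,\sum_{j\in M_i}w_{ij}\}$. Let $\mathrm{OPT}$ be the maximum of $c$ over all assignments, and let $R_{\max}=\max_{i,j}w_{ij}/W_i$ (with $R_{\max}=0$ if there are no pairs $(i,j)$). Put $$g(y)=\frac{e^{y-1}}{1-1/e},\qquad G(y)=\frac{e^{y-1}-1/e}{1-1/e}.$$ **Algorithm.** Start with $Y_i=B_i=0$ for all $i\in L$. When $j$ arrives, put $$m_{ij}=\min\Bigl\{w_{ij},\ \max\Bigl\{0,\ W_i-\sum_{j'<j\text{ assigned to }i}w_{ij'}\Bigr\}\Bigr\}.$$ If $Y_i\ge 1$ for all $i\in L$, leave $j$ unassigned. Otherwise, starting from $x_{ij}=0$ for all $i$, increase $x_{ij}$ at the same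 rate for all $i$ maximizing $m_{ij}\,(1-B_i/W_i)$ (evaluated in the state before the arrival of $j$) until $\sum_i x_{ij}=1$, and then assign $j$ to one random $i$, namely to $i$ with probability $x_{ij}$. For the chosen $i$ the variables are then updated by letting $x$, the share of $j$ received by $i$, grow from $0$ to $1$, with $$dY_i=\frac{m_{ij}}{W_i}\,dx,\qquad dB_i=m_{ij}\,g(Y_i)\,dx ;$$ for the other $i$ they do not change. **Theorem.** On every instance the random assignment $M$ produced by this algorithm satisfies $$\mathbb E[c(M)]\ \ge\ G(1-R_{\max})\Bigl(1-\frac1e\Bigr)\,\mathrm{OPT},\qquad\text{where}\qquad G(1-R_{\max})\Bigl(1-\frac1e\Bigr)=e^{-R_{\max}}-e^{-1}.$$ That is, the algorithm has competitive ratio $e^{-R_{\max}}-e^{-1}$. -/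

import Mathlib

namespace AdditiveBudget

noncomputable section

/-- `g(y) = e^{y-1} / (1 - 1/e)`. -/
def g (y : ℝ) : ℝ := Real.exp (y - 1) / (1 - 1 / Real.exp 1)

/-- `G(y) = (e^{y-1} - 1/e) / (1 - 1/e)`. -/
def G (y : ℝ) : ℝ := (Real.exp (y - 1) - 1 / Real.exp 1) / (1 - 1 / Real.exp 1)

/-- An instance of online matching with additive budgets: a finite set `L` of offline vertices
with budgets `W i > 0`, and online vertices `0, 1, …, n - 1` listed in their order of arrival, with
edge weights `w i j ≥ 0`. A missing edge is an edge of weight `0`: assigning along it earns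
nothing, exactly like leaving the online vertex unassigned. -/
structure Instance (L : Type*) (n : ℕ) where
  w : L → Fin n → ℝ
  W : L → ℝ
  w_nonneg : ∀ i j, 0 ≤ w i j
  W_pos : ∀ i, 0 < W i

/-- An assignment sends every online vertex to at most one offline vertex. -/
abbrev Assignment (L : Type*) (n : ℕ) := Fin n → Option L

section

open scoped Classical

variable {L : Type*} [Fintype L] {n : ℕ}

/-- `R_max = max_{i,j} w_ij / W_i` (and `0` if there is no pair `(i, j)`). -/
def Instance.Rmax (I : Instance L n) : ℝ := ⨆ p : L × Fin n, I.w p.1 p.2 / I.W p.1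

/-- The total weight `∑_{j ∈ M_i} w_ij` of the online vertices that `M` assigns to `i`. -/
def Instance.load (I : Instance L n) (M : Assignment L n) (i : L) : ℝ :=
  ∑ j with M j = some i, I.w i j

/-- The reward `c(M) = ∑_i min {W_i, ∑_{j ∈ M_i} w_ij}`. -/
def Instance.reward (I : Instance L n) (M : Assignment L n) : ℝ :=
  ∑ i, min (I.W i) (I.load M i)

/-- The optimum (offline) reward, a maximum over the finitely many assignments. -/
def Instance.opt (I : Instance L n) : ℝ :=
  (Finset.univ : Finset (Assignment L n)).sup' ⟨fun _ => none, Finset.mem_univ _⟩ I.reward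

/-- What the algorithm maintains along a realization of its random choices: the realized
assignment `M` of the online vertices that have arrived (the others have the value `none`), and
the values of the variables `Y_i` and `B_i` under this realization. -/
structure State (L : Type*) (n : ℕ) where
  M : Assignment L n
  Y : L → ℝ
  B : L → ℝ

/-- Initially nothing is assigned and all variables are `0`. -/
def State.init (L : Type*) (n : ℕ) : State L n := ⟨fun _ => none, fun _ => 0, fun _ => 0⟩

/-- `min {w_ij, max {0, W_i - ∑_{j' assigned to i} w_ij'}}`, the increase of the reward if `j` is
assigned to `i` in the state `σ`. -/
def Instance.gain (I : Instance L n) (σ : State L n) (j : Fin n) (i : L) : ℝ :=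
  min (I.w i j) (max 0 (I.W i - I.load σ.M i))

/-- The quantity that selects the offline vertices for `j`:
`min {w_ij, max {0, W_i - ∑_{j' assigned to i} w_ij'}} * (1 - B_i / W_i)`. -/
def Instance.score (I : Instance L n) (σ : State L n) (j : Fin n) (i : L) : ℝ :=
  I.gain σ j i * (1 - σ.B i / I.W i)

/-- The offline vertices of maximal score for `j` in the state `σ`. -/
def Instance.argmaxSet (I : Instance L n) (σ : State L n) (j : Fin n) : Finset L :=
  {i | ∀ i', I.score σ j i' ≤ I.score σ j i}

theorem Instance.argmaxSet_nonempty (I : Instance L n) (σ : State L n) (j : Fin n)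
    (h : ∃ i, σ.Y i < 1) : (I.argmaxSet σ j).Nonempty := by
  obtain ⟨i₀, _⟩ := h
  obtain ⟨i, _, hi⟩ :=
    Finset.exists_max_image Finset.univ (I.score σ j) ⟨i₀, Finset.mem_univ _⟩
  exact ⟨i, by simpa [Instance.argmaxSet] using fun i' => hi i' (Finset.mem_univ _)⟩

/-- The random decision on `j`, given the realized state `σ` before its arrival. The
probabilities `x_ij` start at `0`. If some `Y_i < 1`, those of all `i` in the argmax set grow at
the same rate until `∑_i x_ij = 1`, so that `j` goes to a uniformly random element of that set;
if all `Y_i` are at least `1`, all `x_ij` stay `0` and `j` is left unassigned. -/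
def Instance.decision (I : Instance L n) (σ : State L n) (j : Fin n) : PMF (Option L) :=
  if h : ∃ i, σ.Y i < 1 then
    (PMF.uniformOfFinset (I.argmaxSet σ j) (I.argmaxSet_nonempty σ j h)).map some
  else PMF.pure none

/-- The state after the decision `o` on `j`. With `X_ij = 1` if `j` is assigned to `i` and
`X_ij = 0` otherwise, `Y_i` increases by `gain * X_ij / W_i`, and `B_i` follows the rule
`dB_i = gain * g(Y_i) dx` while the share `x` of `j` that `i` has received grows from `0` to `X_ij`
(and `Y_i` with it). -/
def Instance.update (I : Instance L n) (σ : State L n) (j : Fin n) (o : Option L) :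
    State L n where
  M := Function.update σ.M j o
  Y i := σ.Y i + I.gain σ j i / I.W i * (if o = some i then 1 else 0)
  B i := σ.B i + ∫ x in (0 : ℝ)..(if o = some i then 1 else 0),
    I.gain σ j i * g (σ.Y i + I.gain σ j i / I.W i * x)

/-- The treatment of one arriving online vertex `j`. -/
def Instance.step (I : Instance L n) (σ : State L n) (j : Fin n) : PMF (State L n) :=
  (I.decision σ j).map (I.update σ j)

/-- The law of the final assignment of the algorithm: the online vertices are treated in the order
`0, 1, …, n - 1`. -/
def Instance.algorithm (I : Instance L n) : PMF (Assignment L n) :=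
  ((List.finRange n).foldl (fun p j => p.bind fun σ => I.step σ j)
    (PMF.pure (State.init L n))).map State.M

/-- The expected reward of the algorithm. -/
def Instance.expectedReward (I : Instance L n) : ℝ :=
  ∑ M : Assignment L n, (I.algorithm M).toReal * I.reward M

end

end

end AdditiveBudget

/-!
The algorithm is competitive on every realization of its random choices. Each arrival raises `Y` of
the chosen vertex `i` by some `δ ≤ R = R_max` and sets aside the score of `i` for the arriving
vertex. Since the score of a fixed pair only decreases in time and `i` has maximal score, what is
set aside for `j` bounds every score of `j` in the final state, and since
`(δ (1 - G y) + e^{-R} (G (y + δ) - G y)) (1 - 1/e) ≤ δ`, the sum of the scores set aside and of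
`e^{-R} ∑ B_i` is at most `∑ W_i Y_i / (1 - 1/e)`, where `∑ W_i Y_i` is the reward of the algorithm.

Conversely, consider an offline vertex `i` that ends with fill level `y`, so that `B_i = W_i G y`.
If `R ≤ 1 - y`, each of the online vertices that the optimum gives to `i` keeps its full weight
in its score; otherwise it keeps at least the fraction `(1 - y) / R`. In both cases these scores
together with `e^{-R} B_i` amount to at least `G (1 - R)` times the reward of the optimum at `i`.
The factor `e^{-R}` absorbs that the scores are evaluated before and not during the growth of `Y`.
-/

namespace AdditiveBudget

open Finset

theorem one_sub_inv_exp_one_pos : 0 < 1 - 1 / Real.exp 1 := by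
  rw [sub_pos, div_lt_one (Real.exp_pos 1)]
  exact Real.one_lt_exp_iff.2 one_pos

theorem G_mul_one_sub_inv_exp_one (y : ℝ) :
    G y * (1 - 1 / Real.exp 1) = Real.exp (y - 1) - Real.exp (-1) := by
  rw [G, div_mul_cancel₀ _ one_sub_inv_exp_one_pos.ne', Real.exp_neg, one_div]

theorem one_sub_G_mul_one_sub_inv_exp_one (y : ℝ) :
    (1 - G y) * (1 - 1 / Real.exp 1) = 1 - Real.exp (y - 1) := by
  rw [sub_mul, G_mul_one_sub_inv_exp_one, Real.exp_neg, one_div]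
  ring

theorem G_zero : G 0 = 0 := by
  simp [G, Real.exp_neg]

theorem G_one : G 1 = 1 := by
  simpa [G] using div_self one_sub_inv_exp_one_pos.ne'

theorem G_monotone : Monotone G := fun x y h => by
  have := one_sub_inv_exp_one_pos.le
  unfold G
  gcongr

theorem G_nonneg {y : ℝ} (h : 0 ≤ y) : 0 ≤ G y := G_zero ▸ G_monotone h

theorem G_le_one {y : ℝ} (h : y ≤ 1) : G y ≤ 1 := G_one ▸ G_monotone h

theorem hasDerivAt_G (y : ℝ) : HasDerivAt G (g y) y :=
  (((hasDerivAt_id y).sub_const 1).exp.sub_const _).div_const _ |>.congr_deriv <| by simp [g]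

theorem continuous_g : Continuous g := by
  unfold g
  fun_prop

theorem integral_g (a b : ℝ) : ∫ y in a..b, g y = G b - G a :=
  intervalIntegral.integral_eq_sub_of_hasDerivAt (fun y _ => hasDerivAt_G y)
    (continuous_g.intervalIntegrable a b)

theorem integral_mul_g {W : ℝ} (hW : W ≠ 0) (m y a b : ℝ) :
    ∫ x in a..b, m * g (y + m / W * x) = W * (G (y + m / W * b) - G (y + m / W * a)) := by
  rw [← integral_g, ← intervalIntegral.mul_integral_comp_add_mul, ← mul_assoc,
    mul_div_cancel₀ _ hW, intervalIntegral.integral_const_mul]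

theorem mul_one_sub_G_add_increment_le {δ R : ℝ} (hδ : 0 ≤ δ) (hδR : δ ≤ R) (y : ℝ) :
    (δ * (1 - G y) + Real.exp (-R) * (G (y + δ) - G y)) * (1 - 1 / Real.exp 1) ≤ δ := by
  have growth : Real.exp (-R) * (Real.exp δ - 1) ≤ δ :=
    calc Real.exp (-R) * (Real.exp δ - 1)
        ≤ Real.exp (-δ) * (Real.exp δ - 1) := by
          gcongr
          exact sub_nonneg.2 (Real.one_le_exp hδ)
      _ = 1 - Real.exp (-δ) := by
          rw [mul_sub, ← Real.exp_add, neg_add_cancel, Real.exp_zero, mul_one]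
      _ ≤ δ := by linarith [Real.add_one_le_exp (-δ)]
  calc (δ * (1 - G y) + Real.exp (-R) * (G (y + δ) - G y)) * (1 - 1 / Real.exp 1)
      = δ * ((1 - G y) * (1 - 1 / Real.exp 1)) + Real.exp (-R) *
          (G (y + δ) * (1 - 1 / Real.exp 1) - G y * (1 - 1 / Real.exp 1)) := by ring
    _ = δ * (1 - Real.exp (y - 1)) + Real.exp (y - 1) * (Real.exp (-R) * (Real.exp δ - 1)) := by
        rw [one_sub_G_mul_one_sub_inv_exp_one, G_mul_one_sub_inv_exp_one,
          G_mul_one_sub_inv_exp_one, add_sub_right_comm, Real.exp_add]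
        ring
    _ ≤ δ * (1 - Real.exp (y - 1)) + Real.exp (y - 1) * δ := by gcongr
    _ = δ := by ring

theorem G_one_sub_le_exp_neg {R : ℝ} (hR : 0 ≤ R) : G (1 - R) ≤ Real.exp (-R) := by
  refine le_of_mul_le_mul_right ?_ one_sub_inv_exp_one_pos
  rw [G_mul_one_sub_inv_exp_one, sub_sub_cancel_left, one_div, ← Real.exp_neg]
  have : Real.exp (-R) * Real.exp (-1) ≤ Real.exp (-1) :=
    mul_le_of_le_one_left (Real.exp_pos _).le (Real.exp_le_one_iff.2 (neg_nonpos.2 hR))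
  linarith

theorem G_one_sub_le_of_exp_neg_le {R y q : ℝ} (hR : 0 ≤ R) (hy : y ≤ 1)
    (hq : Real.exp (-R) ≤ q) : G (1 - R) ≤ q * (1 - G y) + Real.exp (-R) * G y :=
  calc G (1 - R) ≤ Real.exp (-R) := G_one_sub_le_exp_neg hR
    _ = Real.exp (-R) * (1 - G y) + Real.exp (-R) * G y := by ring
    _ ≤ q * (1 - G y) + Real.exp (-R) * G y := by
        gcongr
        exact sub_nonneg.2 (G_le_one hy)

theorem sub_div_mul_le {R : ℝ} (hR : 0 < R) (t s : ℝ) : (t - s / R) * s ≤ R * t ^ 2 / 4 := by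
  have : R * t ^ 2 / 4 - (t - s / R) * s = (R * t / 2 - s) ^ 2 / R := by
    field_simp
    ring
  linarith [div_nonneg (sq_nonneg (R * t / 2 - s)) hR.le]

theorem mul_exp_neg_sq_div_four_le {R : ℝ} (hR : 0 ≤ R) :
    R * Real.exp (-R) ^ 2 / 4 ≤ Real.exp (-1) * (1 - Real.exp (-R)) := by
  have hquarter : 1 / 4 ≤ Real.exp (-1) := by linarith [Real.exp_neg_one_gt_d9]
  have hle : Real.exp (-R) ≤ 1 := Real.exp_le_one_iff.2 (neg_nonpos.2 hR)
  have hmul : R * Real.exp (-R) ≤ 1 - Real.exp (-R) := by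
    have := mul_le_mul_of_nonneg_right (Real.add_one_le_exp R) (Real.exp_pos (-R)).le
    rw [← Real.exp_add, add_neg_cancel, Real.exp_zero] at this
    linarith
  calc R * Real.exp (-R) ^ 2 / 4 = 1 / 4 * (R * Real.exp (-R) * Real.exp (-R)) := by ring
    _ ≤ Real.exp (-1) * (R * Real.exp (-R)) := by
        gcongr
        exact mul_le_of_le_one_right (by positivity) hle
    _ ≤ Real.exp (-1) * (1 - Real.exp (-R)) := by gcongr

theorem G_one_sub_le_div {R y : ℝ} (hR : 0 < R) (hy : y ≤ 1) :
    G (1 - R) ≤ (1 - y) / R * (1 - G y) + Real.exp (-R) * G y := by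
  rcases le_or_gt (Real.exp (-R)) ((1 - y) / R) with hq | hq
  · exact G_one_sub_le_of_exp_neg_le hR.le hy hq
  have deficit : (Real.exp (-R) - (1 - y) / R) * ((1 - G y) * (1 - 1 / Real.exp 1)) ≤
      Real.exp (-1) * (1 - Real.exp (-R)) :=
    calc (Real.exp (-R) - (1 - y) / R) * ((1 - G y) * (1 - 1 / Real.exp 1))
        ≤ (Real.exp (-R) - (1 - y) / R) * (1 - y) := by
          rw [one_sub_G_mul_one_sub_inv_exp_one]
          exact mul_le_mul_of_nonneg_left (by linarith [Real.add_one_le_exp (y - 1)])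
            (sub_nonneg.2 hq.le)
      _ ≤ R * Real.exp (-R) ^ 2 / 4 := sub_div_mul_le hR _ _
      _ ≤ Real.exp (-1) * (1 - Real.exp (-R)) := mul_exp_neg_sq_div_four_le hR.le
  refine le_of_mul_le_mul_right ?_ one_sub_inv_exp_one_pos
  calc G (1 - R) * (1 - 1 / Real.exp 1)
      = Real.exp (-R) * (1 - 1 / Real.exp 1) - Real.exp (-1) * (1 - Real.exp (-R)) := by
        rw [G_mul_one_sub_inv_exp_one, sub_sub_cancel_left, one_div, ← Real.exp_neg]
        ring
    _ ≤ Real.exp (-R) * (1 - 1 / Real.exp 1) -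
          (Real.exp (-R) - (1 - y) / R) * ((1 - G y) * (1 - 1 / Real.exp 1)) :=
        sub_le_sub_left deficit _
    _ = ((1 - y) / R * (1 - G y) + Real.exp (-R) * G y) * (1 - 1 / Real.exp 1) := by ring

theorem exists_mul_le_min_and_G_one_sub_le {W y R : ℝ} (hW : 0 ≤ W) (hR : 0 ≤ R) (hy : y ≤ 1) :
    ∃ q, 0 ≤ q ∧ (∀ w, 0 ≤ w → w ≤ R * W → q * w ≤ min w (W * (1 - y))) ∧
      G (1 - R) ≤ q * (1 - G y) + Real.exp (-R) * G y := by
  rcases le_or_gt R (1 - y) with h | h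
  · refine ⟨1, zero_le_one, fun w _ hwR => ?_,
      G_one_sub_le_of_exp_neg_le hR hy (Real.exp_le_one_iff.2 (neg_nonpos.2 hR))⟩
    rw [one_mul, mul_comm W]
    exact le_min le_rfl (hwR.trans (by gcongr))
  · have hR' : 0 < R := (sub_nonneg.2 hy).trans_lt h
    have hq : 0 ≤ (1 - y) / R := div_nonneg (sub_nonneg.2 hy) hR
    refine ⟨(1 - y) / R, hq, fun w hw hwR => le_min ?_ ?_, G_one_sub_le_div hR' hy⟩
    · exact mul_le_of_le_one_left hw ((div_le_one hR').2 h.le)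
    · calc (1 - y) / R * w ≤ (1 - y) / R * (R * W) := by gcongr
        _ = W * (1 - y) := by field_simp

theorem G_one_sub_mul_min_sum_le {ι : Type*} (s : Finset ι) {w : ι → ℝ} {W y R : ℝ}
    (hW : 0 ≤ W) (hR : 0 ≤ R) (hy₀ : 0 ≤ y) (hy₁ : y ≤ 1) (hw : ∀ j ∈ s, 0 ≤ w j)
    (hwR : ∀ j ∈ s, w j ≤ R * W) :
    G (1 - R) * min W (∑ j ∈ s, w j) ≤
      ∑ j ∈ s, min (w j) (W * (1 - y)) * (1 - G y) + Real.exp (-R) * (W * G y) := by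
  obtain ⟨q, hq, hshare, hG⟩ := exists_mul_le_min_and_G_one_sub_le hW hR hy₁
  have hsum : q * ∑ j ∈ s, w j ≤ ∑ j ∈ s, min (w j) (W * (1 - y)) := by
    rw [mul_sum]
    exact sum_le_sum fun j hj => hshare _ (hw j hj) (hwR j hj)
  have hG₀ := G_nonneg hy₀
  have hG₁ := sub_nonneg.2 (G_le_one hy₁)
  calc G (1 - R) * min W (∑ j ∈ s, w j)
      ≤ (q * (1 - G y) + Real.exp (-R) * G y) * min W (∑ j ∈ s, w j) :=
        mul_le_mul_of_nonneg_right hG (le_min hW (sum_nonneg hw))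
    _ = q * min W (∑ j ∈ s, w j) * (1 - G y) +
          Real.exp (-R) * (min W (∑ j ∈ s, w j) * G y) := by ring
    _ ≤ q * (∑ j ∈ s, w j) * (1 - G y) + Real.exp (-R) * (W * G y) := by
        gcongr
        · exact min_le_right _ _
        · exact min_le_left _ _
    _ ≤ ∑ j ∈ s, min (w j) (W * (1 - y)) * (1 - G y) + Real.exp (-R) * (W * G y) := by
        rw [← sum_mul]
        gcongr

theorem min_add_eq_min_add_min {W l w : ℝ} (hw : 0 ≤ w) :
    min W (l + w) = min W l + min w (max 0 (W - l)) := by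
  rcases le_total W l with h | h
  · rw [min_eq_left h, min_eq_left (by linarith), max_eq_left (by linarith), min_eq_right hw,
      add_zero]
  · rw [min_eq_right h, max_eq_right (by linarith), ← min_add_add_left, min_comm, add_sub_cancel]

open Classical in
theorem sum_sum_filter_eq_some {ι L A : Type*} [Fintype ι] [Fintype L] [AddCommMonoid A]
    (O : ι → Option L) (f : ι → L → A) :
    ∑ i, ∑ j with O j = some i, f j i = ∑ j, (O j).elim 0 (f j) := by
  simp only [sum_filter]
  rw [sum_comm]
  refine sum_congr rfl fun j _ => ?_
  cases O j <;> simp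

theorem le_sum_toReal_mul_of_forall_mem_support {α : Type*} [Fintype α] (p : PMF α) {f : α → ℝ}
    {a : ℝ} (h : ∀ x ∈ p.support, a ≤ f x) : a ≤ ∑ x, (p x).toReal * f x := by
  have hsum : ∑ x, (p x).toReal = 1 := by
    rw [← ENNReal.toReal_sum fun x _ => p.apply_ne_top x, ← tsum_fintype (L := .unconditional _),
      p.tsum_coe, ENNReal.toReal_one]
  calc a = ∑ x, (p x).toReal * a := by rw [← sum_mul, hsum, one_mul]
    _ ≤ ∑ x, (p x).toReal * f x := sum_le_sum fun x _ => by
        by_cases hx : x ∈ p.support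
        · exact mul_le_mul_of_nonneg_left (h x hx) ENNReal.toReal_nonneg
        · simp [(p.apply_eq_zero_iff x).2 hx]

namespace Instance

variable {L : Type*} {n : ℕ} (I : Instance L n)

theorem Rmax_nonneg : 0 ≤ I.Rmax :=
  Real.iSup_nonneg fun _ => div_nonneg (I.w_nonneg _ _) (I.W_pos _).le

theorem w_le_Rmax_mul [Finite L] (i : L) (j : Fin n) : I.w i j ≤ I.Rmax * I.W i :=
  (div_le_iff₀ (I.W_pos i)).1 <|
    le_ciSup (f := fun p : L × Fin n => I.w p.1 p.2 / I.W p.1) (Set.finite_range _).bddAbove (i, j)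

theorem load_nonneg (M : Assignment L n) (i : L) : 0 ≤ I.load M i :=
  sum_nonneg fun j _ => I.w_nonneg i j

theorem load_update_some {M : Assignment L n} {j : Fin n} (hj : M j = none) (i : L) :
    I.load (Function.update M j (some i)) i = I.load M i + I.w i j := by
  unfold load
  rw [add_comm, ← sum_cons (by simp [hj])]
  congr 1
  ext k
  by_cases hk : k = j <;> simp [hk]

theorem load_update_of_ne {M : Assignment L n} {j : Fin n} (hj : M j = none) {o : Option L}
    {i : L} (ho : o ≠ some i) : I.load (Function.update M j o) i = I.load M i := by
  unfold load
  congr 1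
  ext k
  by_cases hk : k = j
  · subst hk
    simp [hj, ho]
  · simp [hk]

section Update

variable (σ : State L n) (j : Fin n)

theorem gain_nonneg (i : L) : 0 ≤ I.gain σ j i :=
  le_min (I.w_nonneg i j) (le_max_left _ _)

theorem gain_div_le_Rmax [Finite L] (i : L) : I.gain σ j i / I.W i ≤ I.Rmax :=
  (div_le_iff₀ (I.W_pos i)).2 ((min_le_left _ _).trans (I.w_le_Rmax_mul i j))

theorem update_Y_some (i : L) :
    (I.update σ j (some i)).Y i = σ.Y i + I.gain σ j i / I.W i := by
  simp [update]

variable {σ j} in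
theorem update_Y_of_ne {o : Option L} {i : L} (ho : o ≠ some i) :
    (I.update σ j o).Y i = σ.Y i := by
  simp [update, ho]

theorem le_update_Y (o : Option L) (i : L) : σ.Y i ≤ (I.update σ j o).Y i := by
  by_cases ho : o = some i
  · subst ho
    rw [update_Y_some]
    exact le_add_of_nonneg_right (div_nonneg (I.gain_nonneg σ j i) (I.W_pos i).le)
  · rw [I.update_Y_of_ne ho]

theorem update_B (o : Option L) (i : L) :
    (I.update σ j o).B i = σ.B i + I.W i * (G ((I.update σ j o).Y i) - G (σ.Y i)) := by
  simp only [update]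
  rw [integral_mul_g (I.W_pos i).ne', mul_zero, add_zero]

variable {σ j} in
theorem min_load_update (hj : σ.M j = none) (o : Option L) (i : L) :
    min (I.W i) (I.load (I.update σ j o).M i) =
      min (I.W i) (I.load σ.M i) + I.W i * ((I.update σ j o).Y i - σ.Y i) := by
  change min _ (I.load (Function.update σ.M j o) i) = _
  by_cases ho : o = some i
  · subst ho
    rw [I.load_update_some hj, min_add_eq_min_add_min (I.w_nonneg i j), update_Y_some,
      add_sub_cancel_left, mul_div_cancel₀ _ (I.W_pos i).ne', gain]
  · rw [I.load_update_of_ne hj ho, I.update_Y_of_ne ho, sub_self, mul_zero, add_zero]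

end Update

variable [Fintype L]

theorem exists_opt_eq_reward : ∃ O, I.opt = I.reward O := by
  obtain ⟨O, -, hO⟩ := exists_mem_eq_sup' ⟨fun _ => none, mem_univ _⟩ I.reward
  exact ⟨O, hO⟩

theorem mem_support_decision {σ : State L n} {j : Fin n} {o : Option L}
    (ho : o ∈ (I.decision σ j).support) :
    (∃ i, o = some i ∧ ∀ i', I.score σ j i' ≤ I.score σ j i) ∨ o = none ∧ ∀ i, 1 ≤ σ.Y i := by
  unfold decision at ho
  split_ifs at ho with h
  · obtain ⟨i, hi, rfl⟩ := (PMF.mem_support_map_iff _ _ _).1 ho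
    rw [PMF.mem_support_uniformOfFinset_iff] at hi
    exact .inl ⟨i, rfl, by simpa [argmaxSet] using hi⟩
  · push Not at h
    exact .inr ⟨(PMF.mem_support_pure_iff _ _).1 ho, h⟩

/-- `I.Reachable S σ` says that some realization of the algorithm is in the state `σ` after it has
treated the online vertices in `S`, in an arbitrary order of arrival. -/
inductive Reachable : Finset (Fin n) → State L n → Prop
  | init : Reachable ∅ (State.init L n)
  | update {S : Finset (Fin n)} {σ : State L n} {j : Fin n} {o : Option L} (h : Reachable S σ)
      (hj : j ∉ S) (ho : o ∈ (I.decision σ j).support) : Reachable (insert j S) (I.update σ j o)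

theorem reachable_of_mem_support_foldl {l : List (Fin n)} (hl : l.Nodup) {τ : State L n}
    (hτ : τ ∈ (l.foldl (fun p j => p.bind fun σ => I.step σ j)
      (PMF.pure (State.init L n))).support) : I.Reachable l.toFinset τ := by
  induction l using List.reverseRecOn generalizing τ with
  | nil =>
    obtain rfl := (PMF.mem_support_pure_iff _ _).1 hτ
    exact .init
  | append_singleton l j ih =>
    rw [List.foldl_concat] at hτ
    obtain ⟨σ, hσ, hστ⟩ := (PMF.mem_support_bind_iff _ _ _).1 hτ
    obtain ⟨o, ho, rfl⟩ := (PMF.mem_support_map_iff _ _ _).1 hστ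
    obtain ⟨hj, hl⟩ := List.nodup_concat _ _ |>.1 (List.concat_eq_append ▸ hl)
    rw [List.toFinset_append, List.toFinset_cons, List.toFinset_nil, insert_empty_eq,
      union_singleton]
    exact (ih hl hσ).update (by simpa using hj) ho

theorem exists_reachable_of_mem_support {M : Assignment L n} (hM : M ∈ I.algorithm.support) :
    ∃ σ, I.Reachable univ σ ∧ σ.M = M := by
  obtain ⟨σ, hσ, rfl⟩ := (PMF.mem_support_map_iff _ _ _).1 hM
  have h := I.reachable_of_mem_support_foldl (List.nodup_finRange n) hσ
  rw [List.toFinset_finRange] at h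
  exact ⟨σ, h, rfl⟩

namespace Reachable

variable {I} {S T : Finset (Fin n)} {σ τ : State L n}

theorem M_eq_none (h : I.Reachable S σ) {j : Fin n} (hj : j ∉ S) : σ.M j = none := by
  induction h with
  | init => rfl
  | update _ _ _ ih =>
    rw [mem_insert, not_or] at hj
    exact (Function.update_of_ne hj.1 _ _).trans (ih hj.2)

theorem W_mul_Y (h : I.Reachable S σ) (i : L) :
    I.W i * σ.Y i = min (I.W i) (I.load σ.M i) := by
  induction h with
  | init => simp [State.init, load, (I.W_pos i).le]
  | update h hj _ ih =>
    rw [I.min_load_update (h.M_eq_none hj), ← ih]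
    ring

theorem B_eq (h : I.Reachable S σ) (i : L) : σ.B i = I.W i * G (σ.Y i) := by
  induction h with
  | init => simp [State.init, G_zero]
  | update _ _ _ ih =>
    rw [I.update_B, ih]
    ring

theorem Y_nonneg (h : I.Reachable S σ) (i : L) : 0 ≤ σ.Y i := by
  refine nonneg_of_mul_nonneg_right ?_ (I.W_pos i)
  rw [h.W_mul_Y]
  exact le_min (I.W_pos i).le (I.load_nonneg _ i)

theorem Y_le_one (h : I.Reachable S σ) (i : L) : σ.Y i ≤ 1 := by
  refine le_of_mul_le_mul_left ?_ (I.W_pos i)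
  rw [h.W_mul_Y, mul_one]
  exact min_le_left _ _

theorem gain_eq (h : I.Reachable S σ) (j : Fin n) (i : L) :
    I.gain σ j i = min (I.w i j) (I.W i * (1 - σ.Y i)) := by
  rw [mul_sub, mul_one, h.W_mul_Y, gain, ← max_sub_sub_left, sub_self]

theorem score_eq_gain_mul (h : I.Reachable S σ) (j : Fin n) (i : L) :
    I.score σ j i = I.gain σ j i * (1 - G (σ.Y i)) := by
  rw [score, h.B_eq, mul_div_cancel_left₀ _ (I.W_pos i).ne']

theorem score_eq (h : I.Reachable S σ) (j : Fin n) (i : L) :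
    I.score σ j i = min (I.w i j) (I.W i * (1 - σ.Y i)) * (1 - G (σ.Y i)) := by
  rw [h.score_eq_gain_mul, h.gain_eq]

theorem score_nonneg (h : I.Reachable S σ) (j : Fin n) (i : L) : 0 ≤ I.score σ j i := by
  rw [h.score_eq_gain_mul]
  exact mul_nonneg (I.gain_nonneg σ j i) (sub_nonneg.2 (G_le_one (h.Y_le_one i)))

theorem score_le_score (hσ : I.Reachable S σ) (hτ : I.Reachable T τ) {i : L}
    (hY : σ.Y i ≤ τ.Y i) (j : Fin n) : I.score τ j i ≤ I.score σ j i := by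
  have hW := (I.W_pos i).le
  rw [hσ.score_eq, hτ.score_eq]
  gcongr
  · exact sub_nonneg.2 (G_le_one (hτ.Y_le_one i))
  · exact le_min (I.w_nonneg i j) (mul_nonneg hW (sub_nonneg.2 (hσ.Y_le_one i)))
  · exact G_monotone hY

theorem score_add_increment_le_gain (h : I.Reachable S σ) (j : Fin n) (i : L) :
    (I.score σ j i + Real.exp (-I.Rmax) *
        (I.W i * (G (σ.Y i + I.gain σ j i / I.W i) - G (σ.Y i)))) * (1 - 1 / Real.exp 1) ≤
      I.gain σ j i := by
  set δ := I.gain σ j i / I.W i with hδ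
  have hgain : I.gain σ j i = I.W i * δ := by rw [hδ, mul_div_cancel₀ _ (I.W_pos i).ne']
  have hδ₀ : 0 ≤ δ := div_nonneg (I.gain_nonneg σ j i) (I.W_pos i).le
  rw [h.score_eq_gain_mul, hgain]
  calc _ = I.W i * ((δ * (1 - G (σ.Y i)) + Real.exp (-I.Rmax) * (G (σ.Y i + δ) - G (σ.Y i))) *
          (1 - 1 / Real.exp 1)) := by ring
    _ ≤ I.W i * δ := mul_le_mul_of_nonneg_left
        (mul_one_sub_G_add_increment_le hδ₀ (I.gain_div_le_Rmax σ j i) _) (I.W_pos i).le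

theorem score_add_increment_le (h : I.Reachable S σ) {j : Fin n} {o : Option L}
    (ho : o ∈ (I.decision σ j).support) (o' : Option L) :
    (o'.elim 0 (I.score σ j) +
        Real.exp (-I.Rmax) * ∑ i, ((I.update σ j o).B i - σ.B i)) * (1 - 1 / Real.exp 1) ≤
      ∑ i, I.W i * ((I.update σ j o).Y i - σ.Y i) := by
  simp only [I.update_B, add_sub_cancel_left]
  rcases I.mem_support_decision ho with ⟨i, rfl, hmax⟩ | ⟨rfl, hfull⟩
  · have hY : ∀ k ≠ i, (I.update σ j (some i)).Y k = σ.Y k := fun k hk =>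
      I.update_Y_of_ne (by simpa using hk.symm)
    have hle : o'.elim 0 (I.score σ j) ≤ I.score σ j i := by
      cases o' with
      | none => exact h.score_nonneg j i
      | some i' => exact hmax i'
    rw [Fintype.sum_eq_single i fun k hk => by rw [hY k hk, sub_self, mul_zero],
      Fintype.sum_eq_single i fun k hk => by rw [hY k hk, sub_self, mul_zero], update_Y_some,
      add_sub_cancel_left, mul_div_cancel₀ _ (I.W_pos i).ne']
    exact (mul_le_mul_of_nonneg_right (add_le_add_left hle _) one_sub_inv_exp_one_pos.le).trans
      (h.score_add_increment_le_gain j i)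
  · have hscore : ∀ i, I.score σ j i = 0 := fun i => by
      rw [h.score_eq_gain_mul, (h.Y_le_one i).antisymm (hfull i), G_one, sub_self, mul_zero]
    have hY : ∀ i, (I.update σ j none).Y i = σ.Y i := fun i => I.update_Y_of_ne (by simp)
    cases o' <;> simp [hY, hscore]

theorem dual_le (h : I.Reachable S σ) (O : Assignment L n) :
    (∑ j ∈ S, (O j).elim 0 (I.score σ j) + Real.exp (-I.Rmax) * ∑ i, σ.B i) *
        (1 - 1 / Real.exp 1) ≤ ∑ i, I.W i * σ.Y i := by
  induction h with
  | init => simp [State.init]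
  | @update S σ j o h hj ho ih =>
    have hle : ∀ k, (O k).elim 0 (I.score (I.update σ j o) k) ≤ (O k).elim 0 (I.score σ k) := by
      intro k
      cases O k with
      | none => exact le_rfl
      | some i => exact h.score_le_score (h.update hj ho) (I.le_update_Y σ j o i) k
    have hstep := h.score_add_increment_le ho (O j)
    have hc := one_sub_inv_exp_one_pos.le
    simp only [mul_sub, sum_sub_distrib] at hstep
    rw [sum_insert hj]
    calc _ ≤ ((O j).elim 0 (I.score σ j) + ∑ k ∈ S, (O k).elim 0 (I.score σ k) +
            Real.exp (-I.Rmax) * ∑ i, (I.update σ j o).B i) * (1 - 1 / Real.exp 1) := by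
          gcongr with k
          · exact hle j
          · exact hle k
      _ ≤ ∑ i, I.W i * (I.update σ j o).Y i := by linarith

theorem G_mul_reward_le_dual (h : I.Reachable S σ) (O : Assignment L n) :
    G (1 - I.Rmax) * I.reward O ≤
      ∑ j, (O j).elim 0 (I.score σ j) + Real.exp (-I.Rmax) * ∑ i, σ.B i := by
  rw [← sum_sum_filter_eq_some O (I.score σ), mul_sum, ← sum_add_distrib, reward, mul_sum]
  refine sum_le_sum fun i _ => ?_
  simp only [h.score_eq, h.B_eq]
  exact G_one_sub_mul_min_sum_le _ (I.W_pos i).le I.Rmax_nonneg (h.Y_nonneg i) (h.Y_le_one i)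
    (fun j _ => I.w_nonneg i j) fun j _ => I.w_le_Rmax_mul i j

theorem G_mul_reward_le_reward (h : I.Reachable univ σ) (O : Assignment L n) :
    G (1 - I.Rmax) * (1 - 1 / Real.exp 1) * I.reward O ≤ I.reward σ.M :=
  calc G (1 - I.Rmax) * (1 - 1 / Real.exp 1) * I.reward O
      = G (1 - I.Rmax) * I.reward O * (1 - 1 / Real.exp 1) := mul_right_comm _ _ _
    _ ≤ (∑ j, (O j).elim 0 (I.score σ j) + Real.exp (-I.Rmax) * ∑ i, σ.B i) *
          (1 - 1 / Real.exp 1) :=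
        mul_le_mul_of_nonneg_right (h.G_mul_reward_le_dual O) one_sub_inv_exp_one_pos.le
    _ ≤ ∑ i, I.W i * σ.Y i := h.dual_le O
    _ = I.reward σ.M := sum_congr rfl fun i _ => h.W_mul_Y i

end Reachable

end Instance

end AdditiveBudget

theorem mainTheorem2_general {L : Type*} [Fintype L] {n : ℕ} (I : AdditiveBudget.Instance L n)
    {M : AdditiveBudget.Assignment L n} (hM : M ∈ I.algorithm.support) :
    AdditiveBudget.G (1 - I.Rmax) * (1 - 1 / Real.exp 1) * I.opt ≤ I.reward M := by
  obtain ⟨σ, hσ, rfl⟩ := I.exists_reachable_of_mem_support hM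
  obtain ⟨O, hO⟩ := I.exists_opt_eq_reward
  exact hO ▸ hσ.G_mul_reward_le_reward O

theorem mainTheorem2 {L : Type*} [Fintype L] {n : ℕ} (I : AdditiveBudget.Instance L n) :
    AdditiveBudget.G (1 - I.Rmax) * (1 - 1 / Real.exp 1)
        = Real.exp (-I.Rmax) - Real.exp (-1) ∧
      AdditiveBudget.G (1 - I.Rmax) * (1 - 1 / Real.exp 1) * I.opt ≤ I.expectedReward :=
  ⟨by rw [AdditiveBudget.G_mul_one_sub_inv_exp_one, sub_sub_cancel_left],
    AdditiveBudget.le_sum_toReal_mul_of_forall_mem_support _ fun _ => mainTheorem2_general I⟩
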